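/- Let $(M,g)$ be a spacetime, i.e. a connected, time-oriented smooth Lorentzian manifold of dimension $n\ge 3$, with Levi-Civita connection $\nabla$, and let $L\subset M$ be a null hypersurface, i.e. a smooth embedded submanifold of codimension one on which the induced metric tensor is degenerate at every point. A null section of $L$ is a smooth nowhere vanishing vector field $\xi\in\mathfrak X(L)$ with $g(\xi,\xi)=0$; its surface gravity is the function $\kappa_\xi\in C^\infty(L)$ determined by $\nabla_\xi\xi=\kappa_\xi\,\xi$. A vector field on $L$ is complete if all its maximal integral curves are defined on the whole of $\mathbb R$. (1) Let $\xi_1,\xi_2\in\mathfrak X(L)$ be null sections of $L$ whose surface gravities are constant and equal to the same number $c\neq 0$. If $\xi_1$ and $\xi_2$ are complete, then $\xi_1=\xi_2$. (2) If $L$ is compact and $\xi_1,\xi_2\in\mathfrak X(L)$ are null sections of $L$ whose surface gravities are nonzero constants $c_1$ and $c_2$ (possibly different), then there is a real number $a\neq 0$ such that $\xi_2=a\,\xi_1$. That is, a null section with nonzero constant surface gravity on a compact null hypersurface is unique up to homothety. -/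

import Mathlib

open scoped Manifold ContDiff

noncomputable section

namespace NullGeometry

/-- A smooth Lorentzian metric on a manifold `M` (without boundary) modelled on `E`: a smooth field
of symmetric bilinear forms on the tangent spaces, of signature `(-, +, …, +)`. The signature is
expressed by the existence, at each point, of a vector `v` with `g(v, v) < 0` on whose
orthogonal complement `g` is positive definite. -/
structure LorentzianMetric (E : Type*) [NormedAddCommGroup E] [NormedSpace ℝ E]
    (M : Type*) [TopologicalSpace M] [ChartedSpace E M] [IsManifold 𝓘(ℝ, E) ∞ M] where
  /-- The bilinear form on each tangent space. -/
  val (p : M) : TangentSpace 𝓘(ℝ, E) p →L[ℝ] TangentSpace 𝓘(ℝ, E) p →L[ℝ] ℝ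
  symm (p : M) (v w : TangentSpace 𝓘(ℝ, E) p) : val p v w = val p w v
  lorentzian (p : M) : ∃ v : TangentSpace 𝓘(ℝ, E) p, val p v v < 0 ∧
    ∀ w : TangentSpace 𝓘(ℝ, E) p, val p v w = 0 → w ≠ 0 → 0 < val p w w
  contMDiff : ContMDiff 𝓘(ℝ, E) (𝓘(ℝ, E).prod 𝓘(ℝ, E →L[ℝ] E →L[ℝ] ℝ)) ∞
    (fun p ↦ Bundle.TotalSpace.mk' (E →L[ℝ] E →L[ℝ] ℝ)
      (E := fun p : M ↦ TangentSpace 𝓘(ℝ, E) p →L[ℝ] TangentSpace 𝓘(ℝ, E) p →L[ℝ] ℝ) p (val p))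

/-- A vector field on `M` is smooth. -/
def IsSmoothVectorField {E : Type*} [NormedAddCommGroup E] [NormedSpace ℝ E]
    {M : Type*} [TopologicalSpace M] [ChartedSpace E M] [IsManifold 𝓘(ℝ, E) ∞ M]
    (X : ∀ p : M, TangentSpace 𝓘(ℝ, E) p) : Prop :=
  ContMDiff 𝓘(ℝ, E) 𝓘(ℝ, E).tangent ∞ (fun p ↦ (⟨p, X p⟩ : TangentBundle 𝓘(ℝ, E) M))

/-- A vector field on `M` is complete: through every point there is an integral curve that is
defined on the whole real line. -/
def IsCompleteVectorField {E : Type*} [NormedAddCommGroup E] [NormedSpace ℝ E]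
    {M : Type*} [TopologicalSpace M] [ChartedSpace E M] [IsManifold 𝓘(ℝ, E) ∞ M]
    (X : ∀ p : M, TangentSpace 𝓘(ℝ, E) p) : Prop :=
  ∀ p : M, ∃ γ : ℝ → M, γ 0 = p ∧ IsMIntegralCurve (I := 𝓘(ℝ, E)) γ X

/-- The Christoffel symbols of the first kind of a field `G` of symmetric bilinear forms on `E`:
the covector `c ↦ ½ (∂_a G(b, c) + ∂_b G(a, c) - ∂_c G(a, b))` at the point `y`. -/
def christoffelFirstKind {E : Type*} [NormedAddCommGroup E] [NormedSpace ℝ E]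
    (G : E → E →L[ℝ] E →L[ℝ] ℝ) (y a b : E) : E →L[ℝ] ℝ :=
  (1 / 2 : ℝ) • (fderiv ℝ G y a b + fderiv ℝ G y b a - ((fderiv ℝ G y).flip a).flip b)

section Spacetime

variable {E : Type*} [NormedAddCommGroup E] [NormedSpace ℝ E]
  {M : Type*} [TopologicalSpace M] [ChartedSpace E M] [IsManifold 𝓘(ℝ, E) ∞ M]

/-- A time orientation of a Lorentzian manifold, given by a globally defined smooth timelike vector
field, which is declared to be future-directed. -/
structure TimeOrientation (g : LorentzianMetric E M) where
  /-- The future-directed timelike vector field. -/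
  field : ∀ p : M, TangentSpace 𝓘(ℝ, E) p
  smooth : IsSmoothVectorField field
  timelike (p : M) : g.val p (field p) (field p) < 0

/-- The differential at `p` of the preferred chart of `M` at `p₀`: it sends a tangent vector at `p` to
its components in this chart. It is invertible when `p` lies in the domain of the chart. -/
def chartDifferential (p₀ p : M) : TangentSpace 𝓘(ℝ, E) p →L[ℝ] E :=
  mvfderiv 𝓘(ℝ, E) (extChartAt 𝓘(ℝ, E) p₀) p

namespace LorentzianMetric

/-- The metric at `p` as a bilinear form. -/
def bilin (g : LorentzianMetric E M) (p : M) : LinearMap.BilinForm ℝ (TangentSpace 𝓘(ℝ, E) p) :=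
  LinearMap.mk₂ ℝ (fun v w ↦ g.val p v w) (by simp) (by simp) (by simp) (by simp)

theorem bilin_apply (g : LorentzianMetric E M) (p : M) (v w : TangentSpace 𝓘(ℝ, E) p) :
    g.bilin p v w = g.val p v w := rfl

theorem eq_zero_of_forall (g : LorentzianMetric E M) (p : M) (u : TangentSpace 𝓘(ℝ, E) p)
    (hu : ∀ w, g.val p u w = 0) : u = 0 := by
  obtain ⟨v, -, hpos⟩ := g.lorentzian p
  by_contra hne
  have h := hpos u (by rw [g.symm]; exact hu v) hne
  rw [hu u] at h
  exact lt_irrefl _ h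

theorem bilin_nondegenerate (g : LorentzianMetric E M) (p : M) : (g.bilin p).Nondegenerate :=
  ⟨fun u hu ↦ g.eq_zero_of_forall p u hu,
    fun u hu ↦ g.eq_zero_of_forall p u fun w ↦ by rw [g.symm]; exact hu w⟩

/-- The metric in the preferred chart `φ` at `p₀`: the matrix `G_y(a, b) = g(dφ⁻¹ a, dφ⁻¹ b)`, as a
function of the coordinate `y`; for basis vectors of `E` these are the components `g_ij`. -/
def inChart (g : LorentzianMetric E M) (p₀ : M) (y : E) : E →L[ℝ] E →L[ℝ] ℝ :=
  let p : M := (extChartAt 𝓘(ℝ, E) p₀).symm y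
  let e : E →L[ℝ] TangentSpace 𝓘(ℝ, E) p := (chartDifferential p₀ p).inverse
  (e.precomp ℝ).comp ((g.val p).comp e)

/-- The covector `w ↦ ½ (∂_u G(v, w) + ∂_v G(u, w) - ∂_w G(u, v))` at `p`, where `G` is the matrix
of the metric in the preferred chart at `p` and all vectors are expressed in this chart. -/
def christoffelCovector (g : LorentzianMetric E M) (p : M) (u v : TangentSpace 𝓘(ℝ, E) p) :
    Module.Dual ℝ (TangentSpace 𝓘(ℝ, E) p) :=
  ((christoffelFirstKind (g.inChart p) (extChartAt 𝓘(ℝ, E) p p) (chartDifferential p p u)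
    (chartDifferential p p v)).comp (chartDifferential p p)).toLinearMap

/-- The Christoffel symbols of the Levi-Civita connection of `g` at `p`, in the preferred chart
at `p`: the vector `Γ(u, v) = Γ^k_ij u^i v^j ∂_k`, obtained from the Christoffel covector by
raising the index with `g`. -/
def christoffel [FiniteDimensional ℝ E] (g : LorentzianMetric E M) (p : M)
    (u v : TangentSpace 𝓘(ℝ, E) p) : TangentSpace 𝓘(ℝ, E) p :=
  haveI : FiniteDimensional ℝ (TangentSpace 𝓘(ℝ, E) p) := inferInstanceAs (FiniteDimensional ℝ E)
  ((g.bilin p).toDual (g.bilin_nondegenerate p)).symm (g.christoffelCovector p u v)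

end LorentzianMetric

variable {F : Type*} [NormedAddCommGroup F] [NormedSpace ℝ F]
  {L : Type*} [TopologicalSpace L] [ChartedSpace F L] [IsManifold 𝓘(ℝ, F) ∞ L]

/-- The Levi-Civita covariant derivative `∇_v V` of a vector field `V` along a map `i : L → M`, in
the direction of `v ∈ T_x L` (the pullback connection). In the preferred chart `φ` of `M` at
`i x`, it is the vector with components `v(V^k) + Γ^k_ij (di v)^i V^j`. -/
def covDerivAlong [FiniteDimensional ℝ E] (g : LorentzianMetric E M) (i : L → M)
    (V : ∀ y : L, TangentSpace 𝓘(ℝ, E) (i y)) (x : L) (v : TangentSpace 𝓘(ℝ, F) x) :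
    TangentSpace 𝓘(ℝ, E) (i x) :=
  (chartDifferential (i x) (i x)).inverse
      (mvfderiv 𝓘(ℝ, F) (fun y ↦ chartDifferential (i x) (i y) (V y)) x v) +
    g.christoffel (i x) (mfderiv 𝓘(ℝ, F) 𝓘(ℝ, E) i x v) (V x)

/-- `i : L → M` is a null hypersurface of `(M, g)`: a smooth embedding of codimension one such that
the induced metric tensor `i^* g` is degenerate at every point of `L`. -/
structure IsNullHypersurface (g : LorentzianMetric E M) (i : L → M) : Prop where
  isSmoothEmbedding : Manifold.IsSmoothEmbedding 𝓘(ℝ, F) 𝓘(ℝ, E) ∞ i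
  codim_one : Module.finrank ℝ F + 1 = Module.finrank ℝ E
  degenerate (x : L) : ∃ v : TangentSpace 𝓘(ℝ, F) x, v ≠ 0 ∧
    ∀ w : TangentSpace 𝓘(ℝ, F) x,
      g.val (i x) (mfderiv 𝓘(ℝ, F) 𝓘(ℝ, E) i x v) (mfderiv 𝓘(ℝ, F) 𝓘(ℝ, E) i x w) = 0

/-- A null section of `L`: a smooth, nowhere vanishing vector field `ξ` on `L`
that is everywhere null for `g`. -/
structure IsNullSection (g : LorentzianMetric E M) (i : L → M)
    (ξ : ∀ x : L, TangentSpace 𝓘(ℝ, F) x) : Prop where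
  smooth : IsSmoothVectorField ξ
  ne_zero (x : L) : ξ x ≠ 0
  null (x : L) : g.val (i x) (mfderiv 𝓘(ℝ, F) 𝓘(ℝ, E) i x (ξ x))
    (mfderiv 𝓘(ℝ, F) 𝓘(ℝ, E) i x (ξ x)) = 0

/-- `κ` is the surface gravity of `L` with respect to `ξ`: `∇_ξ ξ = κ ξ` along `L`. -/
def IsSurfaceGravity [FiniteDimensional ℝ E] (g : LorentzianMetric E M) (i : L → M)
    (ξ : ∀ x : L, TangentSpace 𝓘(ℝ, F) x) (κ : L → ℝ) : Prop :=
  ∀ x : L, covDerivAlong g i (fun y ↦ mfderiv 𝓘(ℝ, F) 𝓘(ℝ, E) i y (ξ y)) x (ξ x) =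
    κ x • mfderiv 𝓘(ℝ, F) 𝓘(ℝ, E) i x (ξ x)

end Spacetime

end NullGeometry

end

namespace NullGeometry

open Filter Topology Bundle

variable {E : Type*} [NormedAddCommGroup E] [NormedSpace ℝ E]
  {M : Type*} [TopologicalSpace M] [ChartedSpace E M] [IsManifold 𝓘(ℝ, E) ∞ M]
  {F : Type*} [NormedAddCommGroup F] [NormedSpace ℝ F]
  {L : Type*} [TopologicalSpace L] [ChartedSpace F L] [IsManifold 𝓘(ℝ, F) ∞ L]

/-! The radical of the degenerate induced metric is a line, because orthogonal null vectors in a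
Lorentzian space are dependent. Hence ξ₂ = f ξ₁ with f nowhere zero, and f is differentiable as a
ratio of chart components. The Leibniz rule gives ∇_{fξ₁}(fξ₁) = f (c₁ f + ξ₁ f) ξ₁; comparing with
c₂ f ξ₁ yields ξ₁ f = c₂ - c₁ f (`mvfderiv_ratio_eq`). Everything else follows from this linear ODE
along the integral curves of ξ₁. (1) If c₁ = c₂ = c, then f - 1 = A exp(-ct) on each curve. When the
curve is defined for all time, A < 0 would force a zero of f, so f ≥ 1 (`one_le_of_mvfderiv_eq`).
Exchanging the two sections gives 1/f ≥ 1. (2) On a compact L, ξ₁ f vanishes at a maximum and at a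
minimum of f, so both extreme values equal c₂ / c₁. -/

/-- Two orthogonal null vectors of a Lorentzian metric are linearly dependent. -/
theorem LorentzianMetric.exists_eq_smul_of_null (g : LorentzianMetric E M) {p : M}
    {u w : TangentSpace 𝓘(ℝ, E) p} (hu : g.val p u u = 0) (hw : g.val p w w = 0)
    (huw : g.val p u w = 0) (hu0 : u ≠ 0) : ∃ a : ℝ, w = a • u := by
  obtain ⟨v, -, hpos⟩ := g.lorentzian p
  have hvu : g.val p v u ≠ 0 := fun h ↦ (hpos u h hu0).ne' hu
  -- This coefficient makes w - a u orthogonal to the timelike v. That vector is also null, hence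
  -- zero, since g is positive definite on the complement of v.
  refine ⟨g.val p v w / g.val p v u, sub_eq_zero.1 ?_⟩
  by_contra hne
  have h1 : g.val p v (w - (g.val p v w / g.val p v u) • u) = 0 := by
    simp [div_mul_cancel₀ _ hvu]
  refine (hpos _ h1 hne).ne' ?_
  have hwu : g.val p w u = 0 := by rw [g.symm]; exact huw
  simp [hu, hw, huw, hwu]

omit [IsManifold 𝓘(ℝ, E) ∞ M] [IsManifold 𝓘(ℝ, F) ∞ L] in
/-- The differential of an immersion is injective. -/
theorem mfderiv_injective_of_isImmersionAt {i : L → M} {x : L}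
    (h : Manifold.IsImmersionAt 𝓘(ℝ, F) 𝓘(ℝ, E) ∞ i x) :
    Function.Injective (mfderiv 𝓘(ℝ, F) 𝓘(ℝ, E) i x) := by
  have hi : MDifferentiableAt 𝓘(ℝ, F) 𝓘(ℝ, E) i x := h.contMDiffAt.mdifferentiableAt (by simp)
  have hcod : MDifferentiableAt 𝓘(ℝ, E) 𝓘(ℝ, E) h.codChart (i x) :=
    (contMDiffAt_of_mem_maximalAtlas h.codChart_mem_maximalAtlas
      h.mem_codChart_source).mdifferentiableAt (by simp)
  have hlin : MDifferentiable 𝓘(ℝ, E) 𝓘(ℝ, F) (fun z : E ↦ (h.equiv.symm z).1) := by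
    rw [mdifferentiable_iff_differentiable]
    fun_prop
  have key : ∀ y ∈ h.domChart.source, (h.equiv.symm (h.codChart (i y))).1 = h.domChart y := by
    intro y hy
    have hy' : h.domChart y ∈ (h.domChart.extend 𝓘(ℝ, F)).target := by
      simpa using h.domChart.map_source hy
    have := h.writtenInCharts hy'
    simp [h.domChart.left_inv hy] at this
    simp [this]
  have hdom : MDifferentiableAt 𝓘(ℝ, F) 𝓘(ℝ, F) h.domChart x :=
    (contMDiffAt_of_mem_maximalAtlas h.domChart_mem_maximalAtlas
      h.mem_domChart_source).mdifferentiableAt (by simp)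
  have hsymm : MDifferentiableAt 𝓘(ℝ, F) 𝓘(ℝ, F) h.domChart.symm (h.domChart x) :=
    (contMDiffAt_symm_of_mem_maximalAtlas h.domChart_mem_maximalAtlas
      (h.domChart.map_source h.mem_domChart_source)).mdifferentiableAt (by simp)
  -- A local left inverse of i: in adapted charts i is the inclusion u ↦ (u, 0), so project to the F
  -- factor and return. The chain rule then gives a left inverse of the differential.
  set G : M → L := fun z ↦ h.domChart.symm (h.equiv.symm (h.codChart z)).1
  have hG : MDifferentiableAt 𝓘(ℝ, E) 𝓘(ℝ, F) G (i x) := by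
    refine MDifferentiableAt.comp (I' := 𝓘(ℝ, F)) (i x) (g := h.domChart.symm)
      (f := fun z ↦ (h.equiv.symm (h.codChart z)).1) ?_ ((hlin _).comp (i x) hcod)
    rwa [key x h.mem_domChart_source]
  have hGi : G ∘ i =ᶠ[𝓝 x] id := by
    filter_upwards [h.domChart.open_source.mem_nhds h.mem_domChart_source] with y hy
    simp [G, key y hy, h.domChart.left_inv hy]
  have hcomp := hGi.mfderiv_eq (I := 𝓘(ℝ, F)) (I' := 𝓘(ℝ, F))
  rw [mfderiv_comp x hG hi, mfderiv_id] at hcomp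
  intro v w hvw
  have := congrArg (mfderiv 𝓘(ℝ, E) 𝓘(ℝ, F) G (i x)) hvw
  have e := fun v ↦ DFunLike.congr_fun hcomp v
  exact (e v).symm.trans (this.trans (e w))

/-! ### Chart components and the Leibniz rule -/

theorem chartDifferential_isInvertible (p : M) :
    (chartDifferential (E := E) p p).IsInvertible :=
  isInvertible_mfderiv_extChartAt (I := 𝓘(ℝ, E)) (mem_extChartAt_source (I := 𝓘(ℝ, E)) p)

omit [IsManifold 𝓘(ℝ, F) ∞ L] in
/-- The components of a smooth vector field along a map in a chart are differentiable. -/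
theorem mdifferentiableAt_chartDifferential {i : L → M} {V : ∀ y : L, TangentSpace 𝓘(ℝ, E) (i y)}
    {x : L} (hV : ContMDiffAt 𝓘(ℝ, F) 𝓘(ℝ, E).tangent ∞
      (fun y ↦ (⟨i y, V y⟩ : TangentBundle 𝓘(ℝ, E) M)) x) :
    MDifferentiableAt 𝓘(ℝ, F) 𝓘(ℝ, E) (fun y ↦ chartDifferential (i x) (i y) (V y)) x := by
  obtain ⟨hi, h2⟩ := contMDiffAt_totalSpace.1 hV
  refine (h2.mdifferentiableAt (by simp)).congr_of_eventuallyEq ?_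
  filter_upwards [hi.continuousAt.preimage_mem_nhds
    ((chartAt E (i x)).open_source.mem_nhds (mem_chart_source E (i x)))] with y hy
  -- The tangent bundle trivialization at i x is the differential of the chart there, so the
  -- components of V are its fibre coordinate.
  have h3 := TangentBundle.continuousLinearMapAt_trivializationAt (I := 𝓘(ℝ, E)) hy
  rw [← Trivialization.continuousLinearMapAt_apply_of_mem (R := ℝ) _ (by simpa using hy)]
  exact (DFunLike.congr_fun h3 (V y)).symm

set_option synthInstance.maxHeartbeats 200000 in
theorem christoffelFirstKind_smul_left (G : E → E →L[ℝ] E →L[ℝ] ℝ) (y u v : E) (a : ℝ) :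
    christoffelFirstKind G y (a • u) v = a • christoffelFirstKind G y u v := by
  ext w
  simp only [christoffelFirstKind, map_smul, smul_apply, add_apply, sub_apply,
    ContinuousLinearMap.flip_apply, smul_eq_mul]
  ring

set_option synthInstance.maxHeartbeats 200000 in
theorem christoffelFirstKind_smul_right (G : E → E →L[ℝ] E →L[ℝ] ℝ) (y u v : E) (a : ℝ) :
    christoffelFirstKind G y u (a • v) = a • christoffelFirstKind G y u v := by
  ext w
  simp only [christoffelFirstKind, map_smul, smul_apply, add_apply, sub_apply,
    ContinuousLinearMap.flip_apply, smul_eq_mul]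
  ring

section CovDeriv

variable [FiniteDimensional ℝ E]

theorem LorentzianMetric.christoffel_smul_left (g : LorentzianMetric E M) (p : M) (a : ℝ)
    (u v : TangentSpace 𝓘(ℝ, E) p) : g.christoffel p (a • u) v = a • g.christoffel p u v := by
  have h : g.christoffelCovector p (a • u) v = a • g.christoffelCovector p u v := by
    simp only [christoffelCovector, map_smul, christoffelFirstKind_smul_left]
    rfl
  simp only [christoffel, h, map_smul]

theorem LorentzianMetric.christoffel_smul_right (g : LorentzianMetric E M) (p : M) (a : ℝ)
    (u v : TangentSpace 𝓘(ℝ, E) p) : g.christoffel p u (a • v) = a • g.christoffel p u v := by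
  have h : g.christoffelCovector p u (a • v) = a • g.christoffelCovector p u v := by
    simp only [christoffelCovector, map_smul, christoffelFirstKind_smul_right]
    rfl
  simp only [christoffel, h, map_smul]

omit [IsManifold 𝓘(ℝ, F) ∞ L] in
theorem covDerivAlong_smul_direction (g : LorentzianMetric E M) (i : L → M)
    (V : ∀ y : L, TangentSpace 𝓘(ℝ, E) (i y)) (x : L) (a : ℝ) (v : TangentSpace 𝓘(ℝ, F) x) :
    covDerivAlong g i V x (a • v) = a • covDerivAlong g i V x v := by
  simp only [covDerivAlong, map_smul, g.christoffel_smul_left, smul_add]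

omit [IsManifold 𝓘(ℝ, F) ∞ L] in
/-- The Leibniz rule for the covariant derivative along a map. -/
theorem covDerivAlong_smul (g : LorentzianMetric E M) (i : L → M)
    (V : ∀ y : L, TangentSpace 𝓘(ℝ, E) (i y)) (x : L) (v : TangentSpace 𝓘(ℝ, F) x)
    (hV : ContMDiffAt 𝓘(ℝ, F) 𝓘(ℝ, E).tangent ∞
      (fun y ↦ (⟨i y, V y⟩ : TangentBundle 𝓘(ℝ, E) M)) x)
    {f : L → ℝ} (hf : MDifferentiableAt 𝓘(ℝ, F) 𝓘(ℝ, ℝ) f x) :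
    covDerivAlong g i (fun y ↦ f y • V y) x v =
      f x • covDerivAlong g i V x v + mvfderiv 𝓘(ℝ, F) f x v • V x := by
  have hW := mdifferentiableAt_chartDifferential hV
  have hinv : (chartDifferential (i x) (i x)).inverse (chartDifferential (i x) (i x) (V x)) = V x :=
    (chartDifferential_isInvertible (i x)).inverse_apply_eq.2 rfl
  have hd := DFunLike.congr_fun (mvfderiv_fun_smul hf hW) v
  simp only [covDerivAlong, map_smul, g.christoffel_smul_right]
  rw [hd]
  simp only [add_apply, smul_apply,
    ContinuousLinearMap.smulRight_apply, map_add, map_smul, hinv, smul_add]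
  abel

end CovDeriv

/-! ### The ratio of two null sections -/

omit [IsManifold 𝓘(ℝ, F) ∞ L] in
/-- If `W₂ = f W₁` with `W₁, W₂` differentiable and `W₁ x ≠ 0`, then `f` is differentiable at `x`. -/
theorem mdifferentiableAt_of_eq_smul {W₁ W₂ : L → F} {f : L → ℝ} {x : L}
    (h₁ : MDifferentiableAt 𝓘(ℝ, F) 𝓘(ℝ, F) W₁ x) (h₂ : MDifferentiableAt 𝓘(ℝ, F) 𝓘(ℝ, F) W₂ x)
    (h : ∀ y, W₂ y = f y • W₁ y) (hx : W₁ x ≠ 0) :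
    MDifferentiableAt 𝓘(ℝ, F) 𝓘(ℝ, ℝ) f x := by
  -- Near x, f is the quotient l(W₂) / l(W₁) of scalar functions.
  obtain ⟨l, hl⟩ := SeparatingDual.exists_ne_zero (R := ℝ) hx
  have hl₁ : MDifferentiableAt 𝓘(ℝ, F) 𝓘(ℝ, ℝ) (fun y ↦ l (W₁ y)) x :=
    l.differentiableAt.comp_mdifferentiableAt h₁
  have hl₂ : MDifferentiableAt 𝓘(ℝ, F) 𝓘(ℝ, ℝ) (fun y ↦ l (W₂ y)) x :=
    l.differentiableAt.comp_mdifferentiableAt h₂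
  have hdiv : MDifferentiableAt 𝓘(ℝ, F) 𝓘(ℝ, ℝ) (fun y ↦ (l (W₁ y))⁻¹ • l (W₂ y)) x :=
    MDifferentiableAt.smul (DifferentiableAt.comp_mdifferentiableAt (g := Inv.inv)
      (f := fun y ↦ l (W₁ y)) (differentiableAt_inv hl) hl₁) hl₂
  refine hdiv.congr_of_eventuallyEq ?_
  filter_upwards [hl₁.continuousAt.eventually_ne hl] with y hy
  simp [h y]
  field_simp

/-- The ratio of two proportional smooth vector fields is differentiable. -/
theorem IsSmoothVectorField.mdifferentiable_of_eq_smul {ξ₁ ξ₂ : ∀ x : L, TangentSpace 𝓘(ℝ, F) x}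
    (h₁ : IsSmoothVectorField ξ₁) (h₂ : IsSmoothVectorField ξ₂) (h0 : ∀ x, ξ₁ x ≠ 0)
    {f : L → ℝ} (h : ∀ x, ξ₂ x = f x • ξ₁ x) : MDifferentiable 𝓘(ℝ, F) 𝓘(ℝ, ℝ) f := by
  intro x
  refine mdifferentiableAt_of_eq_smul
    (mdifferentiableAt_chartDifferential (i := id) (h₁ x))
    (mdifferentiableAt_chartDifferential (i := id) (h₂ x)) (fun y ↦ ?_) fun hx ↦ h0 x ?_
  · exact (congrArg (chartDifferential x y) (h y)).trans (map_smul _ _ _)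
  · have := (chartDifferential_isInvertible (E := F) x).injective
    exact this (hx.trans (map_zero _).symm)

/-- Any two null sections are proportional, since each spans the radical of the induced metric. -/
theorem IsNullHypersurface.exists_eq_smul {g : LorentzianMetric E M} {i : L → M}
    (hL : IsNullHypersurface (F := F) g i) {ξ₁ ξ₂ : ∀ x : L, TangentSpace 𝓘(ℝ, F) x}
    (h₁ : IsNullSection g i ξ₁) (h₂ : IsNullSection g i ξ₂) (x : L) :
    ∃ a : ℝ, a ≠ 0 ∧ ξ₂ x = a • ξ₁ x := by
  have hinj := mfderiv_injective_of_isImmersionAt (hL.isSmoothEmbedding.isImmersion.isImmersionAt x)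
  obtain ⟨v, hv, hdeg⟩ := hL.degenerate x
  have hv' : mfderiv 𝓘(ℝ, F) 𝓘(ℝ, E) i x v ≠ 0 := fun h ↦ hv (hinj (h.trans (map_zero _).symm))
  -- The radical vector v is null and orthogonal to all of T_x L, so every null tangent vector is a
  -- multiple of it.
  have span : ∀ ξ : ∀ x : L, TangentSpace 𝓘(ℝ, F) x, IsNullSection g i ξ →
      ∃ a : ℝ, ξ x = a • v := by
    intro ξ hξ
    obtain ⟨a, ha⟩ := g.exists_eq_smul_of_null (hdeg v) (hξ.null x) (hdeg (ξ x)) hv'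
    exact ⟨a, hinj (ha.trans (map_smul _ _ _).symm)⟩
  obtain ⟨a, ha⟩ := span ξ₁ h₁
  obtain ⟨b, hb⟩ := span ξ₂ h₂
  have ha0 : a ≠ 0 := fun h ↦ h₁.ne_zero x (by simp [ha, h])
  have hb0 : b ≠ 0 := fun h ↦ h₂.ne_zero x (by simp [hb, h])
  exact ⟨b / a, div_ne_zero hb0 ha0, by rw [ha, hb, smul_smul, div_mul_cancel₀ _ ha0]⟩

/-- The ratio `f` of two null sections with constant surface gravities satisfies
`ξ₁ f = c₂ - c₁ f`. -/
theorem mvfderiv_ratio_eq [FiniteDimensional ℝ E] {g : LorentzianMetric E M} {i : L → M}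
    (hL : IsNullHypersurface (F := F) g i) {ξ₁ ξ₂ : ∀ x : L, TangentSpace 𝓘(ℝ, F) x}
    (h₁ : IsNullSection g i ξ₁) {c₁ c₂ : ℝ} (hc₁ : IsSurfaceGravity g i ξ₁ fun _ ↦ c₁)
    (hc₂ : IsSurfaceGravity g i ξ₂ fun _ ↦ c₂) {f : L → ℝ}
    (hf : MDifferentiable 𝓘(ℝ, F) 𝓘(ℝ, ℝ) f) (hf0 : ∀ x, f x ≠ 0) (h : ∀ x, ξ₂ x = f x • ξ₁ x)
    (x : L) : mvfderiv 𝓘(ℝ, F) f x (ξ₁ x) = c₂ - c₁ * f x := by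
  have hinj := mfderiv_injective_of_isImmersionAt (hL.isSmoothEmbedding.isImmersion.isImmersionAt x)
  have hV0 : mfderiv 𝓘(ℝ, F) 𝓘(ℝ, E) i x (ξ₁ x) ≠ 0 :=
    fun h ↦ h₁.ne_zero x (hinj (h.trans (map_zero _).symm))
  have hV : ContMDiff 𝓘(ℝ, F) 𝓘(ℝ, E).tangent ∞
      (fun y ↦ (⟨i y, mfderiv 𝓘(ℝ, F) 𝓘(ℝ, E) i y (ξ₁ y)⟩ : TangentBundle 𝓘(ℝ, E) M)) :=
    (hL.isSmoothEmbedding.contMDiff.contMDiff_tangentMap (m := ∞) (by simp)).comp h₁.smooth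
  have e := hc₂ x
  simp only [h, map_smul] at e
  rw [covDerivAlong_smul g i _ x _ (hV x) (hf x), covDerivAlong_smul_direction, hc₁ x] at e
  simp only [map_smul, smul_smul, ← add_smul, smul_eq_mul] at e
  have e' := smul_left_injective ℝ hV0 e
  have := mul_left_cancel₀ (hf0 x) (a := f x)
    (b := mvfderiv 𝓘(ℝ, F) f x (ξ₁ x)) (c := c₂ - c₁ * f x) (by linarith)
  exact this

/-- A nowhere vanishing solution `f` of `ξ f = c - c f` with `ξ` complete and `c ≠ 0` satisfies
`1 ≤ f`: otherwise `f - 1 = A exp (-c t)` with `A < 0` on an integral curve, and `f` has a zero. -/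
theorem one_le_of_mvfderiv_eq {ξ : ∀ x : L, TangentSpace 𝓘(ℝ, F) x} (hξ : IsCompleteVectorField ξ)
    {c : ℝ} (hc : c ≠ 0) {f : L → ℝ} (hf : MDifferentiable 𝓘(ℝ, F) 𝓘(ℝ, ℝ) f)
    (hf0 : ∀ x, f x ≠ 0) (h : ∀ x, mvfderiv 𝓘(ℝ, F) f x (ξ x) = c - c * f x) (x : L) :
    1 ≤ f x := by
  obtain ⟨γ, rfl, hγ⟩ := hξ x
  have hd : ∀ t, HasDerivAt (f ∘ γ) (c - c * f (γ t)) t := by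
    intro t
    obtain ⟨A, hA, hA1⟩ : ∃ A : ℝ →L[ℝ] ℝ, HasFDerivAt (f ∘ γ) A t ∧ A 1 = c - c * f (γ t) :=
      ⟨_, ((hf (γ t)).hasMFDerivAt.comp t (hγ t)).hasFDerivAt,
        (congrArg (mfderiv 𝓘(ℝ, F) 𝓘(ℝ, ℝ) f (γ t)) (one_smul ℝ (ξ (γ t)))).trans (h (γ t))⟩
    exact hA1 ▸ hA.hasDerivAt
  -- Integrating factor for (f - 1)' = -c (f - 1).
  have hconst : ∀ t, (f (γ t) - 1) * Real.exp (c * t) = f (γ 0) - 1 := by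
    have hd' : ∀ t, HasDerivAt (fun t ↦ (f (γ t) - 1) * Real.exp (c * t)) 0 t := by
      intro t
      refine (((hd t).sub_const 1).mul (((hasDerivAt_id t).const_mul c).exp)).congr_deriv ?_
      simp only [Function.comp_apply, id_eq]
      ring
    intro t
    simpa using is_const_of_deriv_eq_zero (fun t ↦ (hd' t).differentiableAt)
      (fun t ↦ (hd' t).deriv) t 0
  by_contra! hlt
  -- The time t with exp(ct) = 1 - f(γ 0), which is positive by assumption; there f - 1 = -1.
  refine hf0 (γ (Real.log (1 - f (γ 0)) / c)) ?_
  have h1 := hconst (Real.log (1 - f (γ 0)) / c)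
  rw [mul_div_cancel₀ _ hc, Real.exp_log (by linarith)] at h1
  have h2 : f (γ (Real.log (1 - f (γ 0)) / c)) * (1 - f (γ 0)) = 0 := by linarith
  exact (mul_eq_zero.1 h2).resolve_right (by linarith)

-- Fermat's theorem read in a chart. Differentiability is not assumed, since the derivative is 0 by
-- convention where it fails.
omit [IsManifold 𝓘(ℝ, F) ∞ L] in
theorem mvfderiv_eq_zero_of_isLocalExtr {f : L → ℝ} {x : L}
    (hx : IsLocalExtr f x) : mvfderiv 𝓘(ℝ, F) f x = 0 := by
  by_cases hf : MDifferentiableAt 𝓘(ℝ, F) 𝓘(ℝ, ℝ) f x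
  · rw [hf.mvfderiv]
    have hc : ContinuousAt (extChartAt 𝓘(ℝ, F) x).symm (extChartAt 𝓘(ℝ, F) x x) :=
      continuousAt_extChartAt_symm x
    have hx' : IsLocalExtr (f ∘ (extChartAt 𝓘(ℝ, F) x).symm) (extChartAt 𝓘(ℝ, F) x x) := by
      refine IsExtrFilter.comp_tendsto (l := 𝓝 x) ?_ (by simpa [ContinuousAt] using hc)
      rwa [extChartAt_to_inv]
    have := hx'.fderiv_eq_zero
    rw [modelWithCornersSelf_coe, Set.range_id, fderivWithin_univ]
    exact this
  · simp only [mvfderiv, mfderiv_zero_of_not_mdifferentiableAt hf]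
    rfl

end NullGeometry

open NullGeometry in
theorem mainTheorem5
    {E : Type*} [NormedAddCommGroup E] [NormedSpace ℝ E] [FiniteDimensional ℝ E]
    {M : Type*} [TopologicalSpace M] [T2Space M] [SecondCountableTopology M] [ConnectedSpace M]
    [ChartedSpace E M] [IsManifold 𝓘(ℝ, E) ∞ M]
    {F : Type*} [NormedAddCommGroup F] [NormedSpace ℝ F] [FiniteDimensional ℝ F]
    {L : Type*} [TopologicalSpace L] [ChartedSpace F L] [IsManifold 𝓘(ℝ, F) ∞ L]
    (hdim : 3 ≤ Module.finrank ℝ E)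
    (g : LorentzianMetric E M) (_timeOrientation : TimeOrientation g)
    (i : L → M) (hL : IsNullHypersurface (F := F) g i) :
    (∀ c : ℝ, c ≠ 0 → ∀ ξ₁ ξ₂ : ∀ x : L, TangentSpace 𝓘(ℝ, F) x,
      IsNullSection g i ξ₁ → IsNullSection g i ξ₂ →
      IsSurfaceGravity g i ξ₁ (fun _ ↦ c) → IsSurfaceGravity g i ξ₂ (fun _ ↦ c) →
      IsCompleteVectorField ξ₁ → IsCompleteVectorField ξ₂ → ξ₁ = ξ₂) ∧
    (CompactSpace L → ∀ (c₁ c₂ : ℝ), c₁ ≠ 0 → c₂ ≠ 0 →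
      ∀ ξ₁ ξ₂ : ∀ x : L, TangentSpace 𝓘(ℝ, F) x,
      IsNullSection g i ξ₁ → IsNullSection g i ξ₂ →
      IsSurfaceGravity g i ξ₁ (fun _ ↦ c₁) → IsSurfaceGravity g i ξ₂ (fun _ ↦ c₂) →
      ∃ a : ℝ, a ≠ 0 ∧ ∀ x : L, ξ₂ x = a • ξ₁ x) := by
  constructor
  · intro c hc ξ₁ ξ₂ h₁ h₂ hc₁ hc₂ hcomp₁ hcomp₂
    choose f hf0 hf using hL.exists_eq_smul h₁ h₂
    have hinv : ∀ x, ξ₁ x = (f x)⁻¹ • ξ₂ x := fun x ↦ by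
      rw [hf x, smul_smul, inv_mul_cancel₀ (hf0 x), one_smul]
    have hinv0 : ∀ x, (f x)⁻¹ ≠ 0 := fun x ↦ inv_ne_zero (hf0 x)
    have hd := h₁.smooth.mdifferentiable_of_eq_smul h₂.smooth h₁.ne_zero hf
    have hd' := h₂.smooth.mdifferentiable_of_eq_smul h₁.smooth h₂.ne_zero hinv
    funext x
    have hle := one_le_of_mvfderiv_eq hcomp₁ hc hd hf0
      (mvfderiv_ratio_eq hL h₁ hc₁ hc₂ hd hf0 hf) x
    have hle' := one_le_of_mvfderiv_eq hcomp₂ hc hd' hinv0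
      (mvfderiv_ratio_eq hL h₂ hc₂ hc₁ hd' hinv0 hinv) x
    have hfx : f x = 1 := le_antisymm ((one_le_inv₀ (by linarith)).1 hle') hle
    rw [hf x, hfx, one_smul]
  · intro hcompact c₁ c₂ hc₁ hc₂ ξ₁ ξ₂ h₁ h₂ hκ₁ hκ₂
    choose f hf0 hf using hL.exists_eq_smul h₁ h₂
    have hd := h₁.smooth.mdifferentiable_of_eq_smul h₂.smooth h₁.ne_zero hf
    -- The only value of f at which c₂ - c₁ f vanishes. It is chosen before any point, so an empty L
    -- is covered.
    refine ⟨c₂ / c₁, div_ne_zero hc₂ hc₁, fun x ↦ ?_⟩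
    have : Nonempty L := ⟨x⟩
    have hextr : ∀ y, IsLocalExtr f y → f y = c₂ / c₁ := by
      intro y hy
      have := mvfderiv_ratio_eq hL h₁ hκ₁ hκ₂ hd hf0 hf y
      rw [mvfderiv_eq_zero_of_isLocalExtr hy] at this
      simp only [zero_apply] at this
      rw [eq_div_iff hc₁]
      linarith
    obtain ⟨p, hp⟩ := hd.continuous.exists_forall_ge_of_hasCompactSupport
      (HasCompactSupport.of_compactSpace f)
    obtain ⟨q, hq⟩ := hd.continuous.exists_forall_le_of_hasCompactSupport
      (HasCompactSupport.of_compactSpace f)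
    have hp' := hextr p (Or.inr (Filter.Eventually.of_forall hp))
    have hq' := hextr q (Or.inl (Filter.Eventually.of_forall hq))
    rw [hf x, le_antisymm ((hp x).trans_eq hp') (hq'.symm.trans_le (hq x))]
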